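/- Let $E$ be a complex Hilbert space, $\delta T>0$, and let $H(t)$, $t\in[0,\delta T]$, be a (strongly measurable in operator norm) family of bounded self-adjoint operators on $E$ with $\|H(t)\|\le K$ and $H(t)=H(\delta T-t)$ for all $t\in[0,\delta T]$. Write $H_k=H(t_k)$, let $[A,B]=AB-BA$, and let $$\int d^kt := \int\!\cdots\!\int_{0\le t_k\le\dots\le t_1\le\delta T} dt_1\cdots dt_k .$$ Let $$U=\mathcal T\exp\Big(-i\int_0^{\delta T}H(t)\,dt\Big)=\sum_{n\ge0}(-i)^n\int d^nt\,H_1H_2\cdots H_n$$ be the time-ordered exponential, let $U_{\rm tar}=\exp\big(-i\int_0^{\delta T}H(t)\,dt\big)$, and define the Magnus terms $$\Omega_1=\int_0^{\delta T}H(t)\,dt,\qquad \Omega_2=\tfrac12\int d^2t\,[H_1,H_2],\qquad \Omega_3=\tfrac16\int d^3t\,\big([H_1,[H_2,H_3]]+[H_3,[H_2,H_1]]\big),$$ $$\Omega_4=\tfrac1{12}\int d^4t\,\big([[[H_1,H_2],H_3],H_4]+[H_1,[[H_2,H_3],H_4]]+[H_1,[H_2,[H_3,H_4]]]+[H_2,[H_3,[H_4,H_1]]]\big).$$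 Then $\Omega_2=0$ and $\Omega_4=0$. Moreover, there are universal constants $c,C>0$ (independent of $E$, $H$, $K$ and $\delta T$) such that $\|\Omega_3\|\le C(K\delta T)^3$ and, whenever $K\,\delta T\le c$: 1. $U=\exp(-i\Omega_1+i\Omega_3+R)$ for some bounded operator $R$ with $\|R\|\le C(K\delta T)^5$; 2. $\|U-U_{\rm tar}\|\le C(K\delta T)^3$; 3. $U_{\rm tar}^{-1/2}\,U\,U_{\rm tar}^{-1/2}=\exp(i\Omega_3+R')$ for some bounded operator $R'$ with $\|R'\|\le C(K\delta T)^5$, where $U_{\rm tar}^{-1/2}$ is the principal inverse square root of the unitary $U_{\rm tar}$. In particular, as $\delta T\to0$ with $K$ fixed, $U=\exp(-i\Omega_1+i\Omega_3+O(\delta T^5))$, $U-U_{\rm tar}=O(\delta T^3)$ and $U_{\rm tar}^{-1/2}UU_{\rm tar}^{-1/2}=\exp(i\Omega_3+O(\delta T^5))$. -/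

import Mathlib

open MeasureTheory

noncomputable section

namespace Magnus

/-- The ordered simplex `{(t₁, …, t_k) | 0 ≤ t_k ≤ … ≤ t₁ ≤ T}`
(the entry `t 0` is `t₁`, the entry `t 1` is `t₂`, and so on). -/
def simplex (k : ℕ) (T : ℝ) : Set (Fin k → ℝ) :=
  {t | (∀ i, t i ∈ Set.Icc 0 T) ∧ Antitone t}

variable {A : Type*} [NormedRing A] [NormedAlgebra ℂ A]

/-- `∫ dᵏt F(t₁, …, t_k)`, the integral over the ordered simplex with respect to Lebesgue measure. -/
def orderedIntegral (k : ℕ) (T : ℝ) (F : (Fin k → ℝ) → A) : A :=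
  ∫ t in simplex k T, F t

/-- The time-ordered exponential `𝒯 exp(-i ∫₀ᵀ H(t) dt)`, that is, the sum of the Dyson series
`∑ₙ (-i)ⁿ ∫ dⁿt H(t₁) H(t₂) ⋯ H(tₙ)` (later times to the left). -/
def timeOrderedExp (H : ℝ → A) (T : ℝ) : A :=
  ∑' n : ℕ, (-Complex.I) ^ n • orderedIntegral n T (fun t => (List.ofFn fun i => H (t i)).prod)

/-- `Ω₁`. -/
def Omega1 (H : ℝ → A) (T : ℝ) : A :=
  ∫ t in (0 : ℝ)..T, H t

/-- `Ω₂`; the bracket is the commutator `⁅a, b⁆ = a * b - b * a`. -/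
def Omega2 (H : ℝ → A) (T : ℝ) : A :=
  (1 / 2 : ℂ) • orderedIntegral 2 T (fun t => ⁅H (t 0), H (t 1)⁆)

/-- `Ω₃`. -/
def Omega3 (H : ℝ → A) (T : ℝ) : A :=
  (1 / 6 : ℂ) • orderedIntegral 3 T (fun t =>
    ⁅H (t 0), ⁅H (t 1), H (t 2)⁆⁆ + ⁅H (t 2), ⁅H (t 1), H (t 0)⁆⁆)

/-- `Ω₄`. -/
def Omega4 (H : ℝ → A) (T : ℝ) : A :=
  (1 / 12 : ℂ) • orderedIntegral 4 T (fun t =>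
    ⁅⁅⁅H (t 0), H (t 1)⁆, H (t 2)⁆, H (t 3)⁆ + ⁅H (t 0), ⁅⁅H (t 1), H (t 2)⁆, H (t 3)⁆⁆ +
      ⁅H (t 0), ⁅H (t 1), ⁅H (t 2), H (t 3)⁆⁆⁆ + ⁅H (t 1), ⁅H (t 2), ⁅H (t 3), H (t 0)⁆⁆⁆)

/-- `U_tar = exp(-i ∫₀ᵀ H(t) dt)`. -/
def Utar (H : ℝ → A) (T : ℝ) : A :=
  NormedSpace.exp ((-Complex.I) • ∫ t in (0 : ℝ)..T, H t)

/-- The principal inverse square root `U^{-1/2}` of a normal operator, through the continuous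
functional calculus (the principal branch of `z ↦ z^{-1/2}` is continuous off `(-∞, 0]`). -/
def invSqrt {E : Type*} [NormedAddCommGroup E] [InnerProductSpace ℂ E] [CompleteSpace E]
    (U : E →L[ℂ] E) : E →L[ℂ] E :=
  cfc (fun z : ℂ => z ^ (-(1 / 2) : ℂ)) U

end Magnus

end

namespace Magnus

/-! ### Quantitative estimates for the exponential in a Banach algebra. -/

section Exponential

variable {A : Type*} [NormedRing A]

/-! Write `D_n` for the n-th Dyson integral (`dyson`) and `R_n` for the one with the word reversed
(`dysonRev`). The substitution `t ↦ T - t` reverses the simplex, so the symmetry of `H` forces `R_n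
= D_n` at the final time, and kills any integrand that is odd under reversal, such as those of `Ω₂`
and `Ω₄`.

Integration by parts (`integral_mul_integral`) turns products of such integrals into sums of
iterated ones. With `R_n = D_n` this determines the Dyson terms up to order four: `D₂ = D₁²/2`, `D₃
= D₁³/6 + Ω₃`, and, from the fourth-order part of `U⁻¹U = 1`, `D₄ = D₁⁴/24 + (D₁Ω₃ + Ω₃D₁)/2`. With
`x = -iΩ₁` of weight one and `y = iΩ₃` of weight three, the Dyson series therefore agrees through
weight four with `exp (x + y)`. No logarithm or Magnus series is needed.

With `s = K δT`, the tails are `O(s⁵)`, so `U` is within `O(s⁵)` of `exp (x + y)`, and `exp (-x/2) U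
exp (-x/2)` is within `O(s⁵)` of `exp y`. Near the origin `exp` is a small Lipschitz perturbation of
the identity, so a quantitative inverse function theorem (`exists_exp_add_eq`) moves the error into
the exponent. The functional calculus identifies `exp (-x/2)` with the principal inverse square root
of `exp x`. -/

theorem norm_sub_sum_le_of_norm_le_pow {f : ℕ → A} {a : A} (hf : HasSum f a) {r : ℝ}
    (h0 : 0 ≤ r) (hr : r ≤ 1 / 2) (N : ℕ) (hle : ∀ n, N ≤ n → ‖f n‖ ≤ r ^ n) :
    ‖a - ∑ n ∈ Finset.range N, f n‖ ≤ 2 * r ^ N := by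
  have h1 := (hasSum_nat_add_iff' N).2 hf
  have h2 := (hasSum_geometric_of_lt_one h0 (by linarith)).mul_right (r ^ N)
  refine (h1.norm_le_of_bounded h2 fun n => ?_).trans ?_
  · rw [← pow_add]
    exact hle _ (Nat.le_add_left _ _)
  · have : (1 - r)⁻¹ ≤ 2 := by
      rw [inv_le_comm₀ (by linarith) (by norm_num)]
      linarith
    gcongr

theorem norm_pow_succ_sub_pow_succ_le {x y : A} {r : ℝ} (hx : ‖x‖ ≤ r) (hy : ‖y‖ ≤ r) (n : ℕ) :
    ‖x ^ (n + 1) - y ^ (n + 1)‖ ≤ (n + 1) * r ^ n * ‖x - y‖ := by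
  have hr : 0 ≤ r := (norm_nonneg x).trans hx
  induction n with
  | zero => simp
  | succ n ih =>
    have h : x ^ (n + 1 + 1) - y ^ (n + 1 + 1) =
        x ^ (n + 1) * (x - y) + (x ^ (n + 1) - y ^ (n + 1)) * y := by
      rw [pow_succ x (n + 1), pow_succ y (n + 1)]
      noncomm_ring
    have h1 : ‖x ^ (n + 1)‖ ≤ r ^ (n + 1) :=
      (norm_pow_le' x n.succ_pos).trans (pow_le_pow_left₀ (norm_nonneg _) hx _)
    calc ‖x ^ (n + 1 + 1) - y ^ (n + 1 + 1)‖
        ≤ ‖x ^ (n + 1)‖ * ‖x - y‖ + ‖x ^ (n + 1) - y ^ (n + 1)‖ * ‖y‖ := by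
          rw [h]
          exact (norm_add_le _ _).trans (add_le_add (norm_mul_le _ _) (norm_mul_le _ _))
      _ ≤ r ^ (n + 1) * ‖x - y‖ + ((n + 1) * r ^ n * ‖x - y‖) * r := by gcongr
      _ = _ := by push_cast; ring

variable [NormedAlgebra ℂ A]

theorem norm_inv_factorial_smul_le (n : ℕ) (x : A) : ‖((n.factorial : ℂ)⁻¹) • x‖ ≤ ‖x‖ := by
  rw [norm_smul, norm_inv, Complex.norm_natCast]
  refine mul_le_of_le_one_left (norm_nonneg _) (inv_le_one_of_one_le₀ ?_)
  exact_mod_cast Nat.one_le_iff_ne_zero.2 n.factorial_ne_zero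

variable [CompleteSpace A]

/-- `N ≠ 0` keeps `x ^ 0 = 1` out of the tail: nothing is assumed here about `‖1‖`, which vanishes
on the zero space. -/
theorem norm_exp_sub_sum_le {x : A} {r : ℝ} (hx : ‖x‖ ≤ r) (hr : r ≤ 1 / 2) {N : ℕ}
    (hN : N ≠ 0) :
    ‖NormedSpace.exp x - ∑ n ∈ Finset.range N, ((n.factorial : ℂ)⁻¹) • x ^ n‖ ≤ 2 * r ^ N := by
  refine norm_sub_sum_le_of_norm_le_pow (NormedSpace.exp_series_hasSum_exp' (𝕂 := ℂ) x)
    ((norm_nonneg x).trans hx) hr N fun n hn => ?_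
  exact (norm_inv_factorial_smul_le n _).trans
    ((norm_pow_le' x (by omega)).trans (pow_le_pow_left₀ (norm_nonneg _) hx _))

/-- `exp - id` is a contraction near 0: the term of degree `n ≥ 2` has Lipschitz constant at most `n
/ n! · (1/4)^(n-1) ≤ (1/4)^(n-1)`, and these sum to `1/3`. -/
theorem norm_exp_sub_exp_sub_le {x y : A} (hx : ‖x‖ ≤ 1 / 4) (hy : ‖y‖ ≤ 1 / 4) :
    ‖NormedSpace.exp x - NormedSpace.exp y - (x - y)‖ ≤ 1 / 2 * ‖x - y‖ := by
  have h := (NormedSpace.exp_series_hasSum_exp' (𝕂 := ℂ) x).sub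
    (NormedSpace.exp_series_hasSum_exp' (𝕂 := ℂ) y)
  have h1 := (hasSum_nat_add_iff' 2).2 h
  have h2 := (hasSum_geometric_of_lt_one (r := 1 / 4) (by norm_num) (by norm_num)).mul_right
    (1 / 4 * ‖x - y‖)
  have h3 : ∑ i ∈ Finset.range 2, (((i.factorial : ℂ)⁻¹) • x ^ i - ((i.factorial : ℂ)⁻¹) • y ^ i)
      = x - y := by
    simp [Finset.sum_range_succ]
  rw [h3] at h1
  refine (h1.norm_le_of_bounded h2 fun n => ?_).trans ?_
  · rw [← smul_sub, norm_smul, norm_inv, Complex.norm_natCast]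
    have h4 := norm_pow_succ_sub_pow_succ_le hx hy (n + 1)
    have h5 : ((n + 2).factorial : ℝ)⁻¹ * ((n + 1 : ℕ) + 1) ≤ 1 := by
      rw [inv_mul_le_iff₀ (by positivity), mul_one]
      exact_mod_cast Nat.self_le_factorial (n + 2)
    calc ((n + 2).factorial : ℝ)⁻¹ * ‖x ^ (n + 2) - y ^ (n + 2)‖
        ≤ ((n + 2).factorial : ℝ)⁻¹ * (((n + 1 : ℕ) + 1) * (1 / 4) ^ (n + 1) * ‖x - y‖) := by
          gcongr
      _ = (((n + 2).factorial : ℝ)⁻¹ * ((n + 1 : ℕ) + 1)) * ((1 / 4) ^ (n + 1) * ‖x - y‖) := by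
          ring
      _ ≤ 1 * ((1 / 4) ^ (n + 1) * ‖x - y‖) := by gcongr
      _ = _ := by ring
  · have := norm_nonneg (x - y)
    norm_num
    linarith

theorem norm_exp_sub_exp_le {x y : A} (hx : ‖x‖ ≤ 1 / 4) (hy : ‖y‖ ≤ 1 / 4) :
    ‖NormedSpace.exp x - NormedSpace.exp y‖ ≤ 2 * ‖x - y‖ := by
  have h := norm_exp_sub_exp_sub_le hx hy
  have h1 := norm_le_norm_sub_add (NormedSpace.exp x - NormedSpace.exp y) (x - y)
  have := norm_nonneg (x - y)
  linarith

/-- Near the origin the exponential is open with an explicit modulus. -/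
theorem exists_exp_add_eq {x u : A} {δ : ℝ} (hx : ‖x‖ ≤ 1 / 8) (hδ : δ ≤ 1 / 16)
    (hu : ‖u - NormedSpace.exp x‖ ≤ δ) :
    ∃ R : A, ‖R‖ ≤ 2 * δ ∧ NormedSpace.exp (x + R) = u := by
  have hδ0 : 0 ≤ δ := (norm_nonneg _).trans hu
  have happ : ApproximatesLinearOn (NormedSpace.exp : A → A) (ContinuousLinearMap.id ℂ A)
      (Metric.closedBall 0 (1 / 4)) (1 / 2) := by
    intro a ha b hb
    rw [mem_closedBall_zero_iff] at ha hb
    simpa using norm_exp_sub_exp_sub_le ha hb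
  let inv : (ContinuousLinearMap.id ℂ A).NonlinearRightInverse :=
    { toFun := id
      nnnorm := 1
      bound' := fun y => by simp
      right_inv' := fun y => rfl }
  have hsub : Metric.closedBall x (2 * δ) ⊆ Metric.closedBall 0 (1 / 4) := by
    refine Metric.closedBall_subset_closedBall' ?_
    rw [dist_zero_right]
    linarith
  -- The identity has a right inverse of norm 1 and the perturbation has constant 1/2, so the image
  -- of the ball of radius `2δ` contains the ball of radius `(1 - 1/2) · 2δ = δ`.
  have hsurj := happ.surjOn_closedBall_of_nonlinearRightInverse inv (by linarith) hsub
  have hmem : u ∈ Metric.closedBall (NormedSpace.exp x)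
      (((inv.nnnorm : ℝ)⁻¹ - (1 / 2 : NNReal)) * (2 * δ)) := by
    rw [mem_closedBall_iff_norm]
    refine hu.trans (le_of_eq ?_)
    simp only [inv, NNReal.coe_one, NNReal.coe_div, NNReal.coe_ofNat]
    ring
  obtain ⟨y, hy, hyu⟩ := hsurj hmem
  refine ⟨y - x, mem_closedBall_iff_norm.1 hy, ?_⟩
  rw [add_sub_cancel]
  exact hyu

end Exponential

/-! ### Integration over the ordered simplex. -/

section OrderedIntegral

theorem isClosed_simplex (n : ℕ) (T : ℝ) : IsClosed (simplex n T) := by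
  have h : simplex n T = (⋂ i, {t : Fin n → ℝ | t i ∈ Set.Icc 0 T}) ∩ {t | Antitone t} := by
    ext t
    simp [simplex]
  rw [h]
  exact (isClosed_iInter fun i => isClosed_Icc.preimage (continuous_apply i)).inter
    isClosed_antitone

theorem measurableSet_simplex (n : ℕ) (T : ℝ) : MeasurableSet (simplex n T) :=
  (isClosed_simplex n T).measurableSet

theorem simplex_subset_Icc (n : ℕ) (T : ℝ) :
    simplex n T ⊆ Set.Icc (fun _ => 0) (fun _ => T) :=
  fun _ ht => ⟨fun i => (ht.1 i).1, fun i => (ht.1 i).2⟩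

theorem volume_simplex_lt_top (n : ℕ) (T : ℝ) : volume (simplex n T) < ⊤ :=
  (measure_mono (simplex_subset_Icc n T)).trans_lt isCompact_Icc.measure_lt_top

theorem volume_real_simplex_le (n : ℕ) {T : ℝ} (hT : 0 ≤ T) :
    volume.real (simplex n T) ≤ T ^ n := by
  have h := measureReal_mono (μ := volume) (simplex_subset_Icc n T)
    isCompact_Icc.measure_lt_top.ne
  refine h.trans (le_of_eq ?_)
  rw [measureReal_def, Real.volume_Icc_pi_toReal (fun _ => hT)]
  simp

theorem cons_mem_simplex_iff {n : ℕ} {T x : ℝ} {s : Fin n → ℝ} :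
    (Fin.cons x s : Fin (n + 1) → ℝ) ∈ simplex (n + 1) T ↔
      x ∈ Set.Icc 0 T ∧ s ∈ simplex n x := by
  simp only [simplex, Set.mem_ofPred_eq, Fin.forall_fin_succ, Fin.cons_zero, Fin.cons_succ]
  constructor
  · rintro ⟨⟨hx, hs⟩, ha⟩
    refine ⟨hx, fun i => ⟨(hs i).1, ?_⟩, fun i j hij => ?_⟩
    · simpa using ha (Fin.zero_le i.succ)
    · simpa using ha (Fin.succ_le_succ_iff.2 hij)
  · rintro ⟨hx, hs, ha⟩
    refine ⟨⟨hx, fun i => ⟨(hs i).1, (hs i).2.trans hx.2⟩⟩, fun i j hij => ?_⟩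
    induction i using Fin.cases with
    | zero =>
      induction j using Fin.cases with
      | zero => simp
      | succ j => simpa using (hs j).2
    | succ i =>
      induction j using Fin.cases with
      | zero => simp at hij
      | succ j => simpa using ha (Fin.succ_le_succ_iff.1 hij)

variable {A : Type*} [NormedRing A]

theorem integrableOn_simplex {n : ℕ} (T : ℝ) {F : (Fin n → ℝ) → A}
    (hF : AEStronglyMeasurable F volume) {C : ℝ} (hC : ∀ t, ‖F t‖ ≤ C) :
    IntegrableOn F (simplex n T) :=
  IntegrableOn.of_bound (volume_simplex_lt_top n T) hF.restrict C (ae_of_all _ hC)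

variable [NormedAlgebra ℂ A]

theorem orderedIntegral_congr {n : ℕ} {T : ℝ} {F G : (Fin n → ℝ) → A}
    (h : ∀ t ∈ simplex n T, F t = G t) : orderedIntegral n T F = orderedIntegral n T G :=
  setIntegral_congr_fun (measurableSet_simplex n T) h

theorem norm_orderedIntegral_le {n : ℕ} {T : ℝ} (hT : 0 ≤ T) {F : (Fin n → ℝ) → A} {C : ℝ}
    (hC : 0 ≤ C) (hF : ∀ t, ‖F t‖ ≤ C) : ‖orderedIntegral n T F‖ ≤ C * T ^ n :=
  (norm_setIntegral_le_of_norm_le_const (volume_simplex_lt_top n T) fun t _ => hF t).trans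
    (mul_le_mul_of_nonneg_left (volume_real_simplex_le n hT) hC)

theorem orderedIntegral_zero (T : ℝ) (F : (Fin 0 → ℝ) → A) [CompleteSpace A] :
    orderedIntegral 0 T F = F 0 := by
  have h : simplex 0 T = Set.univ :=
    Set.eq_univ_of_forall fun t => ⟨fun i => i.elim0, fun i => i.elim0⟩
  rw [orderedIntegral, h, setIntegral_univ, volume_pi, Measure.pi_of_empty (x := 0),
    integral_dirac]

/-- Integrating out the latest time last. -/
theorem orderedIntegral_succ {n : ℕ} {T : ℝ} (hT : 0 ≤ T) {F : (Fin (n + 1) → ℝ) → A}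
    (hF : IntegrableOn F (simplex (n + 1) T)) :
    orderedIntegral (n + 1) T F =
      ∫ x in (0 : ℝ)..T, orderedIntegral n x (fun s => F (Fin.cons x s)) := by
  have he := (volume_preserving_piFinSuccAbove (fun _ : Fin (n + 1) => ℝ) 0).symm
  have hcons : ∀ p : ℝ × (Fin n → ℝ),
      (MeasurableEquiv.piFinSuccAbove (fun _ : Fin (n + 1) => ℝ) 0).symm p =
        Fin.cons p.1 p.2 := fun p => by
    simp [MeasurableEquiv.piFinSuccAbove, Fin.insertNthEquiv]
  have hind : Integrable ((simplex (n + 1) T).indicator F) :=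
    (integrable_indicator_iff (measurableSet_simplex _ _)).2 hF
  have hint := (he.integrable_comp_emb (MeasurableEquiv.measurableEmbedding _)).2 hind
  rw [orderedIntegral, ← integral_indicator (measurableSet_simplex _ _),
    ← he.integral_comp (MeasurableEquiv.measurableEmbedding _),
    intervalIntegral.integral_of_le hT, ← integral_Icc_eq_integral_Ioc,
    ← integral_indicator measurableSet_Icc]
  rw [Measure.volume_eq_prod] at hint ⊢
  refine (integral_prod _ hint).trans ?_
  congr 1
  ext x
  simp only [Function.comp_apply, hcons]
  by_cases hx : x ∈ Set.Icc 0 T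
  · rw [Set.indicator_of_mem hx, orderedIntegral,
      ← integral_indicator (measurableSet_simplex _ _)]
    congr 1
    ext s
    by_cases hs : s ∈ simplex n x
    · rw [Set.indicator_of_mem hs, Set.indicator_of_mem (cons_mem_simplex_iff.2 ⟨hx, hs⟩)]
    · rw [Set.indicator_of_notMem hs,
        Set.indicator_of_notMem fun h => hs (cons_mem_simplex_iff.1 h).2]
  · rw [Set.indicator_of_notMem hx]
    refine integral_eq_zero_of_ae (ae_of_all _ fun s => ?_)
    exact Set.indicator_of_notMem (fun h => hx (cons_mem_simplex_iff.1 h).1) _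

theorem quasiMeasurePreserving_tail (n : ℕ) :
    Measure.QuasiMeasurePreserving (fun t : Fin (n + 1) → ℝ => Fin.tail t) volume volume := by
  have he := volume_preserving_piFinSuccAbove (fun _ : Fin (n + 1) => ℝ) 0
  exact Measure.quasiMeasurePreserving_snd.comp he.quasiMeasurePreserving

/-- The time reversal `t ↦ T - t` of the ordered simplex. -/
theorem orderedIntegral_reverse (n : ℕ) (T : ℝ) (F : (Fin n → ℝ) → A) :
    orderedIntegral n T (fun t => F (fun i => T - t (Fin.rev i))) = orderedIntegral n T F := by
  let e : (Fin n → ℝ) ≃ᵐ (Fin n → ℝ) :=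
    (MeasurableEquiv.piCongrLeft (fun _ : Fin n => ℝ) Fin.revPerm).trans
      (MeasurableEquiv.piCongrRight fun _ : Fin n => MeasurableEquiv.subLeft T)
  have he : MeasurePreserving e volume volume :=
    (volume_measurePreserving_piCongrLeft (fun _ : Fin n => ℝ) Fin.revPerm).trans
      (volume_preserving_pi fun _ => Measure.measurePreserving_sub_left volume T)
  have happ : ∀ t, e t = fun i => T - t (Fin.rev i) := fun t => by
    ext i
    have h := MeasurableEquiv.piCongrLeft_apply_apply (β := fun _ : Fin n => ℝ) Fin.revPerm t
      (Fin.rev i)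
    rw [Fin.revPerm_apply, Fin.rev_rev] at h
    exact congrArg (T - ·) h
  have hpre : e ⁻¹' simplex n T = simplex n T := by
    ext t
    simp only [Set.mem_preimage, happ, simplex, Set.mem_ofPred_eq, Set.mem_Icc]
    refine and_congr ⟨fun h i => ?_, fun h i => ?_⟩ ⟨fun h i j hij => ?_, fun h i j hij => ?_⟩
    · have := h (Fin.rev i)
      rw [Fin.rev_rev] at this
      constructor <;> linarith
    · have := h (Fin.rev i)
      constructor <;> linarith
    · have := h (Fin.rev_le_rev.2 hij)
      simp only [Fin.rev_rev] at this
      linarith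
    · have := h (Fin.rev_le_rev.2 hij)
      simp only
      linarith
  have h := he.setIntegral_preimage_emb e.measurableEmbedding F (simplex n T)
  rw [hpre] at h
  simpa only [orderedIntegral, happ] using h

end OrderedIntegral

/-! ### Dyson terms as iterated primitives. -/

section IteratedIntegral

variable {A : Type*} [NormedRing A] {H : ℝ → A} {K : ℝ}

theorem intervalIntegrable_of_bound (hm : AEStronglyMeasurable H volume)
    (hK : ∀ t, ‖H t‖ ≤ K) (a b : ℝ) : IntervalIntegrable H volume a b :=
  (intervalIntegrable_const (c := K)).mono_fun hm.restrict
    (ae_of_all _ fun t => (hK t).trans (le_abs_self K))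

theorem aestronglyMeasurable_prod_ofFn (hm : AEStronglyMeasurable H volume) (n : ℕ) :
    AEStronglyMeasurable (fun t : Fin n → ℝ => (List.ofFn fun i => H (t i)).prod) volume := by
  induction n with
  | zero => simp
  | succ n ih =>
    simp only [List.ofFn_succ, List.prod_cons]
    exact (hm.comp_quasiMeasurePreserving (Measure.quasiMeasurePreserving_eval _ 0)).mul
      (ih.comp_quasiMeasurePreserving (quasiMeasurePreserving_tail n))

theorem aestronglyMeasurable_prod_reverse_ofFn (hm : AEStronglyMeasurable H volume) (n : ℕ) :
    AEStronglyMeasurable (fun t : Fin n → ℝ => (List.ofFn fun i => H (t i)).reverse.prod)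
      volume := by
  induction n with
  | zero => simp
  | succ n ih =>
    simp only [List.ofFn_succ, List.reverse_cons, List.prod_append, List.prod_singleton]
    exact (ih.comp_quasiMeasurePreserving (quasiMeasurePreserving_tail n)).mul
      (hm.comp_quasiMeasurePreserving (Measure.quasiMeasurePreserving_eval _ 0))

theorem norm_prod_le_of_forall_norm_le (l : List A) (hl : ∀ a ∈ l, ‖a‖ ≤ K) :
    ‖l.prod‖ ≤ K ^ l.length * ‖(1 : A)‖ := by
  induction l with
  | nil => simp
  | cons a l ih =>
    rw [List.prod_cons, List.length_cons, pow_succ', mul_assoc]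
    exact norm_mul_le_of_le (hl a (by simp)) (ih fun b hb => hl b (by simp [hb]))

theorem norm_prod_ofFn_le (hK : ∀ t, ‖H t‖ ≤ K) {n : ℕ} (t : Fin n → ℝ) :
    ‖(List.ofFn fun i => H (t i)).prod‖ ≤ K ^ n * ‖(1 : A)‖ := by
  refine (norm_prod_le_of_forall_norm_le (K := K) _ fun a ha => ?_).trans_eq
    (by simp)
  obtain ⟨i, rfl⟩ := (List.mem_ofFn' _ _).1 ha
  exact hK _

theorem norm_prod_reverse_ofFn_le (hK : ∀ t, ‖H t‖ ≤ K) {n : ℕ} (t : Fin n → ℝ) :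
    ‖(List.ofFn fun i => H (t i)).reverse.prod‖ ≤ K ^ n * ‖(1 : A)‖ := by
  refine (norm_prod_le_of_forall_norm_le (K := K) _ fun a ha => ?_).trans_eq
    (by simp)
  obtain ⟨i, rfl⟩ := (List.mem_ofFn' _ _).1 (List.mem_reverse.1 ha)
  exact hK _

variable [NormedAlgebra ℂ A]

theorem orderedIntegral_succ_mul (hm : AEStronglyMeasurable H volume) (hK : ∀ t, ‖H t‖ ≤ K)
    {n : ℕ} {T : ℝ} (hT : 0 ≤ T) {F : (Fin n → ℝ) → A} (hF : AEStronglyMeasurable F volume)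
    {C : ℝ} (hC : ∀ t, ‖F t‖ ≤ C) :
    orderedIntegral (n + 1) T (fun t => H (t 0) * F (Fin.tail t)) =
      ∫ x in (0 : ℝ)..T, H x * orderedIntegral n x F := by
  rw [orderedIntegral_succ hT]
  · refine intervalIntegral.integral_congr fun x _ => ?_
    simp only [Fin.cons_zero, Fin.tail_cons]
    exact integral_const_mul_of_integrable (integrableOn_simplex x hF hC)
  · refine integrableOn_simplex T (C := K * C) ?_ fun t => ?_
    · exact (hm.comp_quasiMeasurePreserving (Measure.quasiMeasurePreserving_eval _ 0)).mul
        (hF.comp_quasiMeasurePreserving (quasiMeasurePreserving_tail n))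
    · exact norm_mul_le_of_le (hK _) (hC _)

theorem orderedIntegral_succ_mul' (hm : AEStronglyMeasurable H volume) (hK : ∀ t, ‖H t‖ ≤ K)
    {n : ℕ} {T : ℝ} (hT : 0 ≤ T) {F : (Fin n → ℝ) → A} (hF : AEStronglyMeasurable F volume)
    {C : ℝ} (hC : ∀ t, ‖F t‖ ≤ C) :
    orderedIntegral (n + 1) T (fun t => F (Fin.tail t) * H (t 0)) =
      ∫ x in (0 : ℝ)..T, orderedIntegral n x F * H x := by
  rw [orderedIntegral_succ hT]
  · refine intervalIntegral.integral_congr fun x _ => ?_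
    simp only [Fin.cons_zero, Fin.tail_cons]
    exact integral_mul_const_of_integrable (integrableOn_simplex x hF hC)
  · refine integrableOn_simplex T (C := C * K) ?_ fun t => ?_
    · exact (hF.comp_quasiMeasurePreserving (quasiMeasurePreserving_tail n)).mul
        (hm.comp_quasiMeasurePreserving (Measure.quasiMeasurePreserving_eval _ 0))
    · exact norm_mul_le_of_le (hC _) (hK _)

/-- The Rota–Baxter identity (integration by parts) for primitives in a Banach algebra. -/
theorem integral_mul_integral {f g : ℝ → A} {T : ℝ} (hT : 0 ≤ T)
    (hf : IntegrableOn f (Set.Ioc 0 T)) (hg : IntegrableOn g (Set.Ioc 0 T)) :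
    (∫ x in (0 : ℝ)..T, f x) * (∫ x in (0 : ℝ)..T, g x) =
      (∫ x in (0 : ℝ)..T, f x * ∫ y in (0 : ℝ)..x, g y) +
        ∫ x in (0 : ℝ)..T, (∫ y in (0 : ℝ)..x, f y) * g x := by
  set μ := volume.restrict (Set.Ioc (0 : ℝ) T) with hμ
  have hint : Integrable (fun p : ℝ × ℝ => f p.1 * g p.2) (μ.prod μ) := hf.mul_prod hg
  have hs : MeasurableSet {p : ℝ × ℝ | p.2 ≤ p.1} := measurableSet_le measurable_snd measurable_fst
  have hlow : ∀ x ∈ Set.Ioc 0 T, ∀ h : ℝ → A,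
      ∫ y in (0 : ℝ)..x, h y = ∫ y, (Set.Iic x).indicator h y ∂μ := fun x hx h => by
    rw [intervalIntegral.integral_of_le hx.1.le, integral_indicator measurableSet_Iic, hμ,
      Measure.restrict_restrict measurableSet_Iic]
    congr 2
    ext y
    simp only [Set.mem_Ioc, Set.mem_inter_iff, Set.mem_Iic]
    exact ⟨fun h => ⟨h.2, h.1, h.2.trans hx.2⟩, fun h => ⟨h.2.1, h.1⟩⟩
  -- The strict version is needed because the square is cut into `y ≤ x` and its complement; the
  -- diagonal fibre is null.
  have hlow' : ∀ x ∈ Set.Ioc 0 T, ∀ h : ℝ → A,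
      ∫ y in (0 : ℝ)..x, h y = ∫ y, (Set.Iio x).indicator h y ∂μ := fun x hx h => by
    rw [hlow x hx h]
    refine integral_congr_ae (ae_restrict_of_ae ?_)
    exact indicator_ae_eq_of_ae_eq_set Iio_ae_eq_Iic.symm
  have h1 : (∫ x in (0 : ℝ)..T, f x * ∫ y in (0 : ℝ)..x, g y) =
      ∫ p in {p : ℝ × ℝ | p.2 ≤ p.1}, f p.1 * g p.2 ∂μ.prod μ := by
    rw [← integral_indicator hs, integral_prod _ (hint.indicator hs),
      intervalIntegral.integral_of_le hT]
    refine setIntegral_congr_fun measurableSet_Ioc fun x hx => ?_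
    rw [hlow x hx, ← integral_const_mul_of_integrable (hg.indicator measurableSet_Iic)]
    congr 1
    ext y
    by_cases h : y ≤ x
    · rw [Set.indicator_of_mem (Set.mem_Iic.2 h),
        Set.indicator_of_mem (show (x, y) ∈ {p : ℝ × ℝ | p.2 ≤ p.1} from h)]
    · rw [Set.indicator_of_notMem (by simpa using h),
        Set.indicator_of_notMem (show (x, y) ∉ {p : ℝ × ℝ | p.2 ≤ p.1} from h), mul_zero]
  have h2 : (∫ x in (0 : ℝ)..T, (∫ y in (0 : ℝ)..x, f y) * g x) =
      ∫ p in {p : ℝ × ℝ | p.2 ≤ p.1}ᶜ, f p.1 * g p.2 ∂μ.prod μ := by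
    rw [← integral_indicator hs.compl, integral_prod_symm _ (hint.indicator hs.compl),
      intervalIntegral.integral_of_le hT]
    refine setIntegral_congr_fun measurableSet_Ioc fun x hx => ?_
    rw [hlow' x hx, ← integral_mul_const_of_integrable (hf.indicator measurableSet_Iio)]
    congr 1
    ext y
    by_cases h : y < x
    · rw [Set.indicator_of_mem (Set.mem_Iio.2 h),
        Set.indicator_of_mem (show (y, x) ∈ {p : ℝ × ℝ | p.2 ≤ p.1}ᶜ from not_le.2 h)]
    · rw [Set.indicator_of_notMem (by simpa using h),
        Set.indicator_of_notMem (fun h' => h (not_le.1 h')), zero_mul]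
  rw [h1, h2, integral_add_compl hs hint, integral_prod _ hint,
    intervalIntegral.integral_of_le hT, intervalIntegral.integral_of_le hT]
  refine (integral_mul_const_of_integrable hf).symm.trans (integral_congr_ae (ae_of_all _ ?_))
  exact fun x => (integral_const_mul_of_integrable hg).symm

/-- `∫ dⁿt H(t₁) ⋯ H(tₙ)` as an iterated primitive. -/
noncomputable def dyson (H : ℝ → A) : ℕ → ℝ → A
  | 0, _ => 1
  | n + 1, t => ∫ x in (0 : ℝ)..t, H x * dyson H n x

/-- `∫ dⁿt H(tₙ) ⋯ H(t₁)` as an iterated primitive. -/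
noncomputable def dysonRev (H : ℝ → A) : ℕ → ℝ → A
  | 0, _ => 1
  | n + 1, t => ∫ x in (0 : ℝ)..t, dysonRev H n x * H x

theorem continuous_dyson (hH : ∀ a b, IntervalIntegrable H volume a b) (n : ℕ) : Continuous (dyson H n) := by
  induction n with
  | zero => exact continuous_const
  | succ n ih =>
    refine intervalIntegral.continuous_primitive (fun a b => ?_) 0
    exact (hH a b).mul_continuousOn ih.continuousOn

theorem continuous_dysonRev (hH : ∀ a b, IntervalIntegrable H volume a b) (n : ℕ) :
    Continuous (dysonRev H n) := by
  induction n with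
  | zero => exact continuous_const
  | succ n ih =>
    refine intervalIntegral.continuous_primitive (fun a b => ?_) 0
    exact (hH a b).continuousOn_mul ih.continuousOn

variable [CompleteSpace A]

theorem orderedIntegral_prod_ofFn (hm : AEStronglyMeasurable H volume) (hK : ∀ t, ‖H t‖ ≤ K)
    (n : ℕ) {T : ℝ} (hT : 0 ≤ T) :
    orderedIntegral n T (fun t => (List.ofFn fun i => H (t i)).prod) = dyson H n T := by
  induction n generalizing T with
  | zero => simp [orderedIntegral_zero, dyson]
  | succ n ih =>
    have h := orderedIntegral_succ_mul hm hK hT (aestronglyMeasurable_prod_ofFn hm n)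
      (norm_prod_ofFn_le hK)
    simp only [List.ofFn_succ, List.prod_cons]
    refine h.trans (intervalIntegral.integral_congr fun x hx => ?_)
    rw [Set.uIcc_of_le hT] at hx
    simp only [ih hx.1]

theorem orderedIntegral_prod_reverse_ofFn (hm : AEStronglyMeasurable H volume)
    (hK : ∀ t, ‖H t‖ ≤ K) (n : ℕ) {T : ℝ} (hT : 0 ≤ T) :
    orderedIntegral n T (fun t => (List.ofFn fun i => H (t i)).reverse.prod) = dysonRev H n T := by
  induction n generalizing T with
  | zero => simp [orderedIntegral_zero, dysonRev]
  | succ n ih =>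
    have h := orderedIntegral_succ_mul' hm hK hT (aestronglyMeasurable_prod_reverse_ofFn hm n)
      (norm_prod_reverse_ofFn_le hK)
    simp only [List.ofFn_succ, List.reverse_cons, List.prod_append, List.prod_singleton]
    refine h.trans (intervalIntegral.integral_congr fun x hx => ?_)
    rw [Set.uIcc_of_le hT] at hx
    simp only [ih hx.1]

/-- For a time-symmetric family both orderings give the same iterated integral. -/
theorem dysonRev_eq_dyson (hm : AEStronglyMeasurable H volume) (hK : ∀ t, ‖H t‖ ≤ K)
    {T : ℝ} (hT : 0 ≤ T) (hsymm : ∀ t, H (T - t) = H t) (n : ℕ) :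
    dysonRev H n T = dyson H n T := by
  rw [← orderedIntegral_prod_ofFn hm hK n hT, ← orderedIntegral_prod_reverse_ofFn hm hK n hT,
    ← orderedIntegral_reverse n T fun t => (List.ofFn fun i => H (t i)).prod]
  simp only [hsymm]
  congr 1
  ext t
  congr 1
  refine List.ext_getElem (by simp) fun i h₁ h₂ => ?_
  simp only [List.getElem_reverse, List.getElem_ofFn, List.length_ofFn]
  congr 2
  ext
  simp only [Fin.val_rev]
  omega

end IteratedIntegral

/-! ### Algebraic relations between Dyson terms up to order four. -/

section Symmetric

variable {A : Type*} [NormedRing A] {H : ℝ → A} {K T : ℝ}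

theorem norm_commutator_le {C D : ℝ} {a b : A} (ha : ‖a‖ ≤ C) (hb : ‖b‖ ≤ D) :
    ‖⁅a, b⁆‖ ≤ 2 * (C * D) := by
  have h1 := norm_mul_le_of_le ha hb
  have h2 := norm_mul_le_of_le hb ha
  rw [Ring.lie_def]
  exact (norm_sub_le _ _).trans (by linarith)

theorem aestronglyMeasurable_commutator {X : Type*} [MeasurableSpace X] {μ : Measure X}
    {f g : X → A} (hf : AEStronglyMeasurable f μ) (hg : AEStronglyMeasurable g μ) :
    AEStronglyMeasurable (fun x => ⁅f x, g x⁆) μ := by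
  simp only [Ring.lie_def]
  exact (hf.mul hg).sub (hg.mul hf)

theorem aestronglyMeasurable_apply (hm : AEStronglyMeasurable H volume) {n : ℕ} (i : Fin n) :
    AEStronglyMeasurable (fun t : Fin n → ℝ => H (t i)) volume :=
  hm.comp_quasiMeasurePreserving (Measure.quasiMeasurePreserving_eval _ i)

theorem integrableOn_commutator (hm : AEStronglyMeasurable H volume) (hK : ∀ t, ‖H t‖ ≤ K)
    (x : ℝ) {n : ℕ} (i j : Fin n) :
    IntegrableOn (fun t : Fin n → ℝ => ⁅H (t i), H (t j)⁆) (simplex n x) :=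
  integrableOn_simplex x (aestronglyMeasurable_commutator (aestronglyMeasurable_apply hm i)
    (aestronglyMeasurable_apply hm j)) fun _ => norm_commutator_le (hK _) (hK _)

theorem integrableOn_commutator_commutator (hm : AEStronglyMeasurable H volume)
    (hK : ∀ t, ‖H t‖ ≤ K) (x : ℝ) {n : ℕ} (i j k : Fin n) :
    IntegrableOn (fun t : Fin n → ℝ => ⁅H (t i), ⁅H (t j), H (t k)⁆⁆) (simplex n x) :=
  integrableOn_simplex x (aestronglyMeasurable_commutator (aestronglyMeasurable_apply hm i)
    (aestronglyMeasurable_commutator (aestronglyMeasurable_apply hm j)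
      (aestronglyMeasurable_apply hm k)))
    fun _ => norm_commutator_le (hK _) (norm_commutator_le (hK _) (hK _))

variable [NormedAlgebra ℂ A]

/-- With `I(j, k) = ∫ R_j H D_k`, integration by parts reads `R_{j+1} D_{k+1} = I(j, k+1) + I(j+1,
k)`, which makes alternating sums telescope. -/
theorem dysonRev_mul_dyson (hH : ∀ a b, IntervalIntegrable H volume a b) (hT : 0 ≤ T) (j k : ℕ) :
    dysonRev H (j + 1) T * dyson H (k + 1) T =
      (∫ x in (0 : ℝ)..T, dysonRev H j x * H x * dyson H (k + 1) x) +
        ∫ x in (0 : ℝ)..T, dysonRev H (j + 1) x * H x * dyson H k x := by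
  have hf : IntervalIntegrable (fun x => dysonRev H j x * H x) volume 0 T :=
    (hH 0 T).continuousOn_mul (continuous_dysonRev hH j).continuousOn
  have hg : IntervalIntegrable (fun x => H x * dyson H k x) volume 0 T :=
    (hH 0 T).mul_continuousOn (continuous_dyson hH k).continuousOn
  have h := integral_mul_integral hT hf.1 hg.1
  simp only [← mul_assoc] at h
  simpa only [dysonRev, dyson, mul_assoc] using h

theorem integral_dysonRev_zero (k : ℕ) :
    ∫ x in (0 : ℝ)..T, dysonRev H 0 x * H x * dyson H k x = dyson H (k + 1) T := by
  simp [dysonRev, dyson]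

theorem integral_dyson_zero (j : ℕ) :
    ∫ x in (0 : ℝ)..T, dysonRev H j x * H x * dyson H 0 x = dysonRev H (j + 1) T := by
  simp [dysonRev, dyson]

theorem dysonRev_one (T : ℝ) : dysonRev H 1 T = dyson H 1 T := by
  simp [dysonRev, dyson]

theorem dyson_one_mul_self (hH : ∀ a b, IntervalIntegrable H volume a b) (hT : 0 ≤ T) :
    dyson H 1 T * dyson H 1 T = dyson H 2 T + dysonRev H 2 T := by
  have h := dysonRev_mul_dyson hH hT 0 0
  rwa [integral_dysonRev_zero, integral_dyson_zero, dysonRev_one] at h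

/-- The fourth-order part of the identity `U⁻¹ U = 1`. -/
theorem dyson_antipode_four (hH : ∀ a b, IntervalIntegrable H volume a b) (hT : 0 ≤ T) :
    dyson H 4 T - dysonRev H 1 T * dyson H 3 T + dysonRev H 2 T * dyson H 2 T -
      dysonRev H 3 T * dyson H 1 T + dysonRev H 4 T = 0 := by
  -- The interior integrals `I(1, 2)` and `I(2, 1)` each occur twice with opposite signs; the ends
  -- `I(0, 3)` and `I(3, 0)` are `D₄` and `R₄`.
  rw [dysonRev_mul_dyson hH hT 0 2, dysonRev_mul_dyson hH hT 1 1, dysonRev_mul_dyson hH hT 2 0,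
    integral_dysonRev_zero, integral_dyson_zero]
  abel

/-- Eliminates the two mixed integrals that occur in the expanded triple commutator. After one
integration by parts, `D₁R₁ = D₁² = D₂ + R₂` is applied under the integral. -/
theorem dyson_one_mul_dysonRev_two (hH : ∀ a b, IntervalIntegrable H volume a b) (hT : 0 ≤ T) :
    dyson H 1 T * dysonRev H 2 T =
      (∫ x in (0 : ℝ)..T, H x * dysonRev H 2 x) + (∫ x in (0 : ℝ)..T, dyson H 2 x * H x) +
        dysonRev H 3 T := by
  have hg : IntervalIntegrable (fun x => dysonRev H 1 x * H x) volume 0 T :=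
    (hH 0 T).continuousOn_mul (continuous_dysonRev hH 1).continuousOn
  have h := integral_mul_integral hT (hH 0 T).1 hg.1
  have h1 : ∫ x in (0 : ℝ)..T, (∫ y in (0 : ℝ)..x, H y) * (dysonRev H 1 x * H x) =
      ∫ x in (0 : ℝ)..T, (dyson H 2 x * H x + dysonRev H 2 x * H x) := by
    refine intervalIntegral.integral_congr fun x hx => ?_
    rw [Set.uIcc_of_le hT] at hx
    have h2 := dyson_one_mul_self hH hx.1
    rw [← add_mul, ← h2, dysonRev_one, mul_assoc]
    simp [dyson]
  rw [h1, intervalIntegral.integral_add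
    ((hH 0 T).continuousOn_mul (continuous_dyson hH 2).continuousOn)
    ((hH 0 T).continuousOn_mul (continuous_dysonRev hH 2).continuousOn), ← add_assoc] at h
  simpa [dyson, dysonRev] using h

/-- A function on the simplex that is odd under time reversal integrates to zero. -/
theorem orderedIntegral_eq_zero_of_odd {n : ℕ} {F : (Fin n → ℝ) → A}
    (hF : ∀ t, F (fun i => T - t (Fin.rev i)) = -F t) : orderedIntegral n T F = 0 := by
  have h := orderedIntegral_reverse n T F
  simp only [hF] at h
  have h1 : orderedIntegral n T (fun t => -F t) = -orderedIntegral n T F := integral_neg _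
  rw [h1] at h
  have h2 : (2 : ℂ) • orderedIntegral n T F = 0 := by
    rw [two_smul]
    nth_rewrite 1 [← h]
    exact neg_add_cancel _
  exact (smul_eq_zero.1 h2).resolve_left two_ne_zero

theorem Omega2_eq_zero (hsymm : ∀ t, H (T - t) = H t) : Omega2 H T = 0 := by
  rw [Omega2, orderedIntegral_eq_zero_of_odd, smul_zero]
  intro t
  simp only [hsymm]
  simp [Fin.rev, Ring.lie_def]

/-- Reversing the order of the four operators changes the sign of the integrand, an identity of
noncommutative polynomials. -/
theorem Omega4_eq_zero (hsymm : ∀ t, H (T - t) = H t) : Omega4 H T = 0 := by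
  rw [Omega4, orderedIntegral_eq_zero_of_odd, smul_zero]
  intro t
  have h0 : Fin.rev (0 : Fin 4) = 3 := rfl
  have h1 : Fin.rev (1 : Fin 4) = 2 := rfl
  have h2 : Fin.rev (2 : Fin 4) = 1 := rfl
  have h3 : Fin.rev (3 : Fin 4) = 0 := rfl
  simp only [hsymm, h0, h1, h2, h3, Ring.lie_def]
  noncomm_ring

/-- Time reversal exchanges the two nested commutators, so their integrals coincide. -/
theorem Omega3_eq (hm : AEStronglyMeasurable H volume) (hK : ∀ t, ‖H t‖ ≤ K)
    (hsymm : ∀ t, H (T - t) = H t) :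
    Omega3 H T = (1 / 3 : ℂ) • orderedIntegral 3 T (fun t => ⁅H (t 0), ⁅H (t 1), H (t 2)⁆⁆) := by
  have h := orderedIntegral_reverse 3 T fun t => ⁅H (t 0), ⁅H (t 1), H (t 2)⁆⁆
  have h0 : Fin.rev (0 : Fin 3) = 2 := rfl
  have h1 : Fin.rev (1 : Fin 3) = 1 := rfl
  have h2 : Fin.rev (2 : Fin 3) = 0 := rfl
  simp only [hsymm, h0, h1, h2] at h
  have hadd : orderedIntegral 3 T
      (fun t => ⁅H (t 0), ⁅H (t 1), H (t 2)⁆⁆ + ⁅H (t 2), ⁅H (t 1), H (t 0)⁆⁆) = _ :=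
    integral_add (integrableOn_commutator_commutator hm hK T (0 : Fin 3) 1 2)
      (integrableOn_commutator_commutator hm hK T (2 : Fin 3) 1 0)
  rw [Omega3, hadd]
  simp only [orderedIntegral] at h ⊢
  rw [h]
  module

theorem norm_Omega3_le (hK : ∀ t, ‖H t‖ ≤ K) (hT : 0 ≤ T) :
    ‖Omega3 H T‖ ≤ 2 * (K * T) ^ 3 := by
  have hK0 : 0 ≤ K := (norm_nonneg _).trans (hK 0)
  -- Each double commutator has four words of norm at most `K³`; the factor 1/6 leaves `8/6 ≤ 2`.
  have h := norm_orderedIntegral_le (n := 3) hT (C := 8 * K ^ 3) (by positivity)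
    (F := fun t => ⁅H (t 0), ⁅H (t 1), H (t 2)⁆⁆ + ⁅H (t 2), ⁅H (t 1), H (t 0)⁆⁆) fun t => by
      refine (norm_add_le_of_le (norm_commutator_le (hK _) (norm_commutator_le (hK _) (hK _)))
        (norm_commutator_le (hK _) (norm_commutator_le (hK _) (hK _)))).trans_eq ?_
      ring
  rw [Omega3, norm_smul]
  norm_num
  have : 0 ≤ (K * T) ^ 3 := by positivity
  rw [mul_assoc, ← mul_pow] at h
  linarith

variable [CompleteSpace A]

theorem orderedIntegral_two_commutator (hm : AEStronglyMeasurable H volume)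
    (hK : ∀ t, ‖H t‖ ≤ K) (hT : 0 ≤ T) :
    orderedIntegral 2 T (fun t => ⁅H (t 0), H (t 1)⁆) = dyson H 2 T - dysonRev H 2 T := by
  rw [← orderedIntegral_prod_ofFn hm hK 2 hT, ← orderedIntegral_prod_reverse_ofFn hm hK 2 hT]
  refine Eq.trans ?_ (integral_sub
    (integrableOn_simplex T (aestronglyMeasurable_prod_ofFn hm 2) (norm_prod_ofFn_le hK))
    (integrableOn_simplex T (aestronglyMeasurable_prod_reverse_ofFn hm 2)
      (norm_prod_reverse_ofFn_le hK)))
  simp [orderedIntegral, List.ofFn_succ, Ring.lie_def]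

/-- For fixed latest time `x` the inner commutator integrates to `D₂(x) - R₂(x)`; the outer bracket
with `H x` then gives four terms. -/
theorem orderedIntegral_three_commutator (hm : AEStronglyMeasurable H volume)
    (hK : ∀ t, ‖H t‖ ≤ K) (hT : 0 ≤ T) :
    orderedIntegral 3 T (fun t => ⁅H (t 0), ⁅H (t 1), H (t 2)⁆⁆) =
      dyson H 3 T - (∫ x in (0 : ℝ)..T, H x * dysonRev H 2 x) -
        ((∫ x in (0 : ℝ)..T, dyson H 2 x * H x) - dysonRev H 3 T) := by
  have hH := intervalIntegrable_of_bound hm hK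
  have hint := integrableOn_commutator_commutator hm hK T (0 : Fin 3) 1 2
  have hint2 := fun x => integrableOn_commutator hm hK x (0 : Fin 2) 1
  have hl : ∀ n, IntervalIntegrable (fun x => H x * dyson H n x) volume 0 T :=
    fun n => (hH 0 T).mul_continuousOn (continuous_dyson hH n).continuousOn
  have hl' : ∀ n, IntervalIntegrable (fun x => H x * dysonRev H n x) volume 0 T :=
    fun n => (hH 0 T).mul_continuousOn (continuous_dysonRev hH n).continuousOn
  have hr : ∀ n, IntervalIntegrable (fun x => dyson H n x * H x) volume 0 T :=
    fun n => (hH 0 T).continuousOn_mul (continuous_dyson hH n).continuousOn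
  have hr' : ∀ n, IntervalIntegrable (fun x => dysonRev H n x * H x) volume 0 T :=
    fun n => (hH 0 T).continuousOn_mul (continuous_dysonRev hH n).continuousOn
  have hD : dyson H 3 T = ∫ x in (0 : ℝ)..T, H x * dyson H 2 x := rfl
  have hR : dysonRev H 3 T = ∫ x in (0 : ℝ)..T, dysonRev H 2 x * H x := rfl
  rw [orderedIntegral_succ hT hint, hD, hR, ← intervalIntegral.integral_sub (hl 2) (hl' 2),
    ← intervalIntegral.integral_sub (hr 2) (hr' 2),
    ← intervalIntegral.integral_sub ((hl 2).sub (hl' 2)) ((hr 2).sub (hr' 2))]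
  refine intervalIntegral.integral_congr fun x hx => ?_
  rw [Set.uIcc_of_le hT] at hx
  have h2 := orderedIntegral_two_commutator hm hK hx.1
  rw [← mul_sub, ← sub_mul, ← h2, orderedIntegral, orderedIntegral,
    ← integral_const_mul_of_integrable (hint2 x), ← integral_mul_const_of_integrable (hint2 x),
    ← integral_sub ((hint2 x).const_mul _) ((hint2 x).mul_const _)]
  rfl

theorem dyson_two_eq (hm : AEStronglyMeasurable H volume) (hK : ∀ t, ‖H t‖ ≤ K) (hT : 0 ≤ T)
    (hsymm : ∀ t, H (T - t) = H t) : dyson H 2 T = (1 / 2 : ℂ) • dyson H 1 T ^ 2 := by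
  have h := dyson_one_mul_self (intervalIntegrable_of_bound hm hK) hT
  rw [dysonRev_eq_dyson hm hK hT hsymm] at h
  rw [pow_two, h]
  module

/-- The triple commutator integral equals `D₃ + 2R₃ - D₁R₂`; under symmetry this is `3D₃ - D₁³/2`,
and it is also `3Ω₃`. -/
theorem dyson_three_eq (hm : AEStronglyMeasurable H volume) (hK : ∀ t, ‖H t‖ ≤ K) (hT : 0 ≤ T)
    (hsymm : ∀ t, H (T - t) = H t) :
    dyson H 3 T = (1 / 6 : ℂ) • dyson H 1 T ^ 3 + Omega3 H T := by
  have h := dyson_one_mul_dysonRev_two (intervalIntegrable_of_bound hm hK) hT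
  rw [dysonRev_eq_dyson hm hK hT hsymm, dysonRev_eq_dyson hm hK hT hsymm,
    dyson_two_eq hm hK hT hsymm, mul_smul_comm, ← pow_succ'] at h
  have h3 : dyson H 1 T ^ 3 = (2 : ℂ) • ((1 / 2 : ℂ) • dyson H 1 T ^ (2 + 1)) := by
    rw [smul_smul]; norm_num
  rw [h3, h, Omega3_eq hm hK hsymm, orderedIntegral_three_commutator hm hK hT,
    dysonRev_eq_dyson hm hK hT hsymm]
  module

theorem dyson_four_eq (hm : AEStronglyMeasurable H volume) (hK : ∀ t, ‖H t‖ ≤ K) (hT : 0 ≤ T)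
    (hsymm : ∀ t, H (T - t) = H t) :
    dyson H 4 T = (1 / 24 : ℂ) • dyson H 1 T ^ 4 +
      (1 / 2 : ℂ) • (dyson H 1 T * Omega3 H T + Omega3 H T * dyson H 1 T) := by
  have h := dyson_antipode_four (intervalIntegrable_of_bound hm hK) hT
  simp only [dysonRev_eq_dyson hm hK hT hsymm] at h
  rw [dyson_two_eq hm hK hT hsymm, dyson_three_eq hm hK hT hsymm] at h
  simp only [mul_add, add_mul, mul_smul_comm, smul_mul_assoc, ← pow_succ, ← pow_succ', ← pow_add,
    smul_smul] at h
  norm_num at h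
  linear_combination (norm := module) (1 / 2 : ℂ) • h

end Symmetric

/-! ### Error bounds from agreement through weight four. -/

section Estimates

variable {A : Type*} [NormedRing A] [NormedAlgebra ℂ A]

theorem sum_range_five_exp (x : A) :
    ∑ n ∈ Finset.range 5, ((n.factorial : ℂ)⁻¹) • x ^ n =
      1 + x + (1 / 2 : ℂ) • x ^ 2 + (1 / 6 : ℂ) • x ^ 3 + (1 / 24 : ℂ) • x ^ 4 := by
  simp [Finset.sum_range_succ, Nat.factorial]

/-- The Taylor polynomial of `exp (x + y)` of total weight four, where `x` has weight one and `y`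
has weight three. -/
noncomputable def weightedTaylor (x y : A) : A :=
  1 + x + (1 / 2 : ℂ) • x ^ 2 + (1 / 6 : ℂ) • x ^ 3 + (1 / 24 : ℂ) • x ^ 4 +
    (y + (1 / 2 : ℂ) • (x * y + y * x))

variable [CompleteSpace A] {x y u : A} {s : ℝ}

/-- What the quartic Taylor polynomial of `exp` at `x + y` has beyond `weightedTaylor` is of weight
at least five: `y²` and the parts of the cube and fourth power that involve `y`. -/
theorem norm_sub_exp_add_le (hs0 : 0 ≤ s) (hs : s ≤ 1 / 20) (hx : ‖x‖ ≤ s) (hy : ‖y‖ ≤ 2 * s ^ 3)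
    (hu : ‖u - weightedTaylor x y‖ ≤ 2 * s ^ 5) :
    ‖u - NormedSpace.exp (x + y)‖ ≤ 100 * s ^ 5 := by
  have hs3 : 2 * s ^ 3 ≤ s := by nlinarith [sq_nonneg s, mul_nonneg hs0 hs0]
  have hs6 : s ^ 6 ≤ s ^ 5 := pow_le_pow_of_le_one hs0 (by linarith) (by norm_num)
  have hxy : ‖x + y‖ ≤ 2 * s := (norm_add_le_of_le hx hy).trans (by linarith)
  have h1 := norm_exp_sub_sum_le hxy (by linarith) (N := 5) (by norm_num)
  rw [sum_range_five_exp] at h1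
  have h3 := norm_pow_succ_sub_pow_succ_le hxy (hx.trans (by linarith : s ≤ 2 * s)) 2
  have h4 := norm_pow_succ_sub_pow_succ_le hxy (hx.trans (by linarith : s ≤ 2 * s)) 3
  have h2 : ‖y ^ 2‖ ≤ (2 * s ^ 3) ^ 2 :=
    (norm_pow_le' y two_pos).trans (pow_le_pow_left₀ (norm_nonneg _) hy 2)
  rw [add_sub_cancel_left] at h3 h4
  have h3' := h3.trans (mul_le_mul_of_nonneg_left hy (by positivity))
  have h4' := h4.trans (mul_le_mul_of_nonneg_left hy (by positivity))
  set e := NormedSpace.exp (x + y) with he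
  have hdecomp : u - e = (u - weightedTaylor x y) -
      (e - (1 + (x + y) + (1 / 2 : ℂ) • (x + y) ^ 2 + (1 / 6 : ℂ) • (x + y) ^ 3 +
        (1 / 24 : ℂ) • (x + y) ^ 4)) -
      ((1 / 2 : ℂ) • y ^ 2 + (1 / 6 : ℂ) • ((x + y) ^ (2 + 1) - x ^ (2 + 1)) +
        (1 / 24 : ℂ) • ((x + y) ^ (3 + 1) - x ^ (3 + 1))) := by
    have hsq : (x + y) ^ 2 = x ^ 2 + (x * y + y * x) + y ^ 2 := by noncomm_ring
    rw [weightedTaylor, hsq]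
    module
  have hr : ‖(1 / 2 : ℂ) • y ^ 2 + (1 / 6 : ℂ) • ((x + y) ^ (2 + 1) - x ^ (2 + 1)) +
        (1 / 24 : ℂ) • ((x + y) ^ (3 + 1) - x ^ (3 + 1))‖ ≤
      1 / 2 * ‖y ^ 2‖ + 1 / 6 * ‖(x + y) ^ (2 + 1) - x ^ (2 + 1)‖ +
        1 / 24 * ‖(x + y) ^ (3 + 1) - x ^ (3 + 1)‖ := by
    refine (norm_add₃_le).trans (le_of_eq ?_)
    simp only [norm_smul]
    norm_num
  rw [hdecomp]
  refine (norm_sub_le _ _).trans ((add_le_add (norm_sub_le _ _) le_rfl).trans ?_)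
  push_cast at h3' h4'
  nlinarith

/-- Write `u = exp x + Z + e` with `Z = y + (xy + yx)/2` and `W = exp (-x/2)`. Then `W exp(x) W =
1`, while in `W Z W` the first-order part `-x/2` of `W` cancels `(xy + yx)/2`, leaving `1 + y` up to
weight five. -/
theorem norm_conj_sub_exp_le (h1 : ‖(1 : A)‖ ≤ 1) (hs0 : 0 ≤ s) (hs : s ≤ 1 / 20) (hx : ‖x‖ ≤ s)
    (hy : ‖y‖ ≤ 2 * s ^ 3) (hu : ‖u - weightedTaylor x y‖ ≤ 2 * s ^ 5) :
    ‖NormedSpace.exp ((-(1 / 2) : ℂ) • x) * u * NormedSpace.exp ((-(1 / 2) : ℂ) • x) -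
      NormedSpace.exp y‖ ≤ 100 * s ^ 5 := by
  have hs3 : 2 * s ^ 3 ≤ s := by nlinarith [sq_nonneg s, mul_nonneg hs0 hs0]
  have hs6 : s ^ 6 ≤ s ^ 5 := pow_le_pow_of_le_one hs0 (by linarith) (by norm_num)
  have hs4 : s ^ 4 ≤ s ^ 3 := pow_le_pow_of_le_one hs0 (by linarith) (by norm_num)
  set W := NormedSpace.exp ((-(1 / 2) : ℂ) • x) with hW
  set v := (-(1 / 2) : ℂ) • x with hv
  have hvn : ‖v‖ ≤ s / 2 := by
    rw [hv, norm_smul]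
    norm_num
    linarith
  have hWW : W * NormedSpace.exp x * W = 1 := by
    let _ : NormedAlgebra ℚ A := NormedAlgebra.restrictScalars ℚ ℂ A
    have hc1 : Commute v x := (Commute.refl x).smul_left _
    have hc2 : Commute (v + x) v := (Commute.refl v).add_left hc1.symm
    rw [hW, ← NormedSpace.exp_add_of_commute hc1, ← NormedSpace.exp_add_of_commute hc2]
    have : v + x + v = 0 := by rw [hv]; module
    rw [this, NormedSpace.exp_zero]
  obtain ⟨w, hw, hwn⟩ : ∃ w : A, W = 1 + v + w ∧ ‖w‖ ≤ 2 * s ^ 2 := by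
    refine ⟨W - (1 + v), by abel, ?_⟩
    have h := norm_exp_sub_sum_le (hvn.trans (by linarith : s / 2 ≤ s)) (by linarith) (N := 2)
      (by norm_num)
    simpa [Finset.sum_range_succ] using h
  have hVn : ‖1 + v‖ ≤ 2 := (norm_add_le_of_le h1 hvn).trans (by linarith)
  have hWn : ‖W‖ ≤ 2 := by
    rw [hw]
    refine (norm_add_le_of_le (norm_add_le_of_le h1 hvn) hwn).trans ?_
    nlinarith
  obtain ⟨Z, hZ⟩ : ∃ Z : A, Z = y + (1 / 2 : ℂ) • (x * y + y * x) := ⟨_, rfl⟩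
  have hxyn : ‖x * y + y * x‖ ≤ 4 * s ^ 4 :=
    (norm_add_le_of_le (norm_mul_le_of_le hx hy) (norm_mul_le_of_le hy hx)).trans
      (le_of_eq (by ring))
  have hhalf : ∀ {a : A} {r : ℝ}, ‖a‖ ≤ r → ‖(1 / 2 : ℂ) • a‖ ≤ 1 / 2 * r := by
    intro a r ha
    rw [norm_smul]
    norm_num
    linarith
  have hZn : ‖Z‖ ≤ 4 * s ^ 3 := by
    rw [hZ]
    exact (norm_add_le_of_le hy (hhalf hxyn)).trans (by linarith)
  obtain ⟨e, he, hen⟩ : ∃ e : A, u = NormedSpace.exp x + Z + e ∧ ‖e‖ ≤ 4 * s ^ 5 := by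
    refine ⟨u - weightedTaylor x y - (NormedSpace.exp x - ∑ n ∈ Finset.range 5,
      ((n.factorial : ℂ)⁻¹) • x ^ n), ?_, ?_⟩
    · rw [sum_range_five_exp, weightedTaylor, hZ]
      abel
    · refine (norm_sub_le_of_le hu (norm_exp_sub_sum_le hx (by linarith) (by norm_num))).trans ?_
      linarith
  obtain ⟨f, hf, hfn⟩ : ∃ f : A, NormedSpace.exp y = 1 + y + f ∧ ‖f‖ ≤ 8 * s ^ 5 := by
    refine ⟨NormedSpace.exp y - (1 + y), by abel, ?_⟩
    have h := norm_exp_sub_sum_le hy (by linarith) (N := 2) (by norm_num)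
    simp only [Finset.sum_range_succ, Finset.sum_range_zero, Nat.factorial, pow_zero,
      pow_one] at h
    norm_num at h
    nlinarith
  have hdecomp : W * u * W - NormedSpace.exp y = W * e * W + (w * Z * W + (1 + v) * Z * w) +
      ((1 / 2 : ℂ) • (v * (x * y + y * x) + (x * y + y * x) * v) + v * Z * v) - f := by
    -- The weight-four terms cancel here: `vy + yv = -(xy + yx)/2`.
    have hvZ : (1 + v) * Z * (1 + v) =
        y + ((1 / 2 : ℂ) • (v * (x * y + y * x) + (x * y + y * x) * v) + v * Z * v) := by
      have : (1 + v) * Z * (1 + v) = Z + v * Z + Z * v + v * Z * v := by noncomm_ring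
      rw [this]
      nth_rewrite 1 [hZ]
      nth_rewrite 1 [hZ]
      nth_rewrite 1 [hZ]
      rw [hv]
      simp only [mul_add, add_mul, mul_smul_comm, smul_mul_assoc, smul_add, smul_smul]
      module
    have hWZ : W * Z * W = (1 + v) * Z * (1 + v) + (w * Z * W + (1 + v) * Z * w) := by
      rw [hw]
      noncomm_ring
    have hWu : W * u * W = W * NormedSpace.exp x * W + W * Z * W + W * e * W := by
      rw [he]
      noncomm_ring
    rw [hWu, hWW, hWZ, hvZ, hf]
    abel
  have b1 : ‖W * e * W‖ ≤ 2 * (4 * s ^ 5) * 2 := norm_mul_le_of_le (norm_mul_le_of_le hWn hen) hWn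
  have b2 : ‖w * Z * W‖ ≤ 2 * s ^ 2 * (4 * s ^ 3) * 2 :=
    norm_mul_le_of_le (norm_mul_le_of_le hwn hZn) hWn
  have b3 : ‖(1 + v) * Z * w‖ ≤ 2 * (4 * s ^ 3) * (2 * s ^ 2) :=
    norm_mul_le_of_le (norm_mul_le_of_le hVn hZn) hwn
  have b4 : ‖(1 / 2 : ℂ) • (v * (x * y + y * x) + (x * y + y * x) * v)‖ ≤
      1 / 2 * (s / 2 * (4 * s ^ 4) + 4 * s ^ 4 * (s / 2)) :=
    hhalf (norm_add_le_of_le (norm_mul_le_of_le hvn hxyn) (norm_mul_le_of_le hxyn hvn))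
  have b5 : ‖v * Z * v‖ ≤ s / 2 * (4 * s ^ 3) * (s / 2) :=
    norm_mul_le_of_le (norm_mul_le_of_le hvn hZn) hvn
  rw [hdecomp]
  refine (norm_sub_le_of_le (norm_add_le_of_le (norm_add_le_of_le b1 (norm_add_le_of_le b2 b3))
    (norm_add_le_of_le b4 b5)) hfn).trans ?_
  have : 0 ≤ s ^ 5 := by positivity
  linarith

end Estimates

/-! ### Comparing the Dyson series with the weighted Taylor polynomial. -/

section TimeOrdered

variable {A : Type*} [NormedRing A] [NormedAlgebra ℂ A] {H : ℝ → A} {K T : ℝ}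

theorem dyson_one_eq (H : ℝ → A) (T : ℝ) : dyson H 1 T = Omega1 H T := by
  simp [dyson, Omega1]

theorem norm_Omega1_le (hK : ∀ t, ‖H t‖ ≤ K) (hT : 0 ≤ T) : ‖Omega1 H T‖ ≤ K * T := by
  have h := intervalIntegral.norm_integral_le_of_norm_le_const (a := 0) (b := T) fun t _ => hK t
  rwa [sub_zero, abs_of_nonneg hT] at h

variable [CompleteSpace A]

theorem norm_dyson_le (h1 : ‖(1 : A)‖ ≤ 1) (hm : AEStronglyMeasurable H volume)
    (hK : ∀ t, ‖H t‖ ≤ K) (hT : 0 ≤ T) (n : ℕ) : ‖dyson H n T‖ ≤ (K * T) ^ n := by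
  have hK0 : 0 ≤ K := (norm_nonneg _).trans (hK 0)
  rw [← orderedIntegral_prod_ofFn hm hK n hT, mul_pow]
  refine norm_orderedIntegral_le hT (by positivity) fun t => (norm_prod_ofFn_le hK t).trans ?_
  exact mul_le_of_le_one_right (by positivity) h1

theorem norm_timeOrderedExp_sub_le (h1 : ‖(1 : A)‖ ≤ 1) (hm : AEStronglyMeasurable H volume)
    (hK : ∀ t, ‖H t‖ ≤ K) (hT : 0 ≤ T) (hsymm : ∀ t, H (T - t) = H t) (hs : K * T ≤ 1 / 2) :
    ‖timeOrderedExp H T -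
      weightedTaylor (-(Complex.I • Omega1 H T)) (Complex.I • Omega3 H T)‖ ≤ 2 * (K * T) ^ 5 := by
  have hK0 : 0 ≤ K := (norm_nonneg _).trans (hK 0)
  have hs0 : 0 ≤ K * T := mul_nonneg hK0 hT
  have hbound : ∀ n, ‖(-Complex.I) ^ n • dyson H n T‖ ≤ (K * T) ^ n := fun n => by
    rw [norm_smul, norm_pow, norm_neg, Complex.norm_I, one_pow, one_mul]
    exact norm_dyson_le h1 hm hK hT n
  have hsum : Summable fun n => (-Complex.I) ^ n • dyson H n T :=
    Summable.of_norm_bounded (summable_geometric_of_lt_one hs0 (by linarith)) hbound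
  have htsum : timeOrderedExp H T = ∑' n, (-Complex.I) ^ n • dyson H n T := by
    simp only [timeOrderedExp, orderedIntegral_prod_ofFn hm hK _ hT]
  have h := norm_sub_sum_le_of_norm_le_pow hsum.hasSum hs0 hs 5 fun n _ => hbound n
  rw [← htsum] at h
  convert h using 3
  have h3 : (-Complex.I) ^ 3 = Complex.I := by
    rw [pow_succ, neg_sq, Complex.I_sq]; ring
  have h4 : (-Complex.I) ^ 4 = 1 := by
    rw [show 4 = 2 * 2 from rfl, pow_mul, neg_sq, Complex.I_sq]; norm_num
  have hneg : -(Complex.I • Omega1 H T) = (-Complex.I) • Omega1 H T := (neg_smul _ _).symm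
  have h0 : dyson H 0 T = 1 := rfl
  have h2 : (-Complex.I) ^ 2 = -1 := by rw [neg_sq, Complex.I_sq]
  simp only [Finset.sum_range_succ, Finset.sum_range_zero, dyson_two_eq hm hK hT hsymm,
    dyson_three_eq hm hK hT hsymm, dyson_four_eq hm hK hT hsymm, dyson_one_eq, h0, hneg,
    weightedTaylor, smul_pow, h2, h3, h4, pow_zero, pow_one, smul_mul_assoc, mul_smul_comm,
    smul_smul, mul_neg, neg_mul, Complex.I_mul_I, smul_add, zero_add]
  module

end TimeOrdered

/-! ### Dependence on the values of the family on `[0, T]` only. -/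

section Congruence

variable {A : Type*} [NormedRing A] [NormedAlgebra ℂ A] {G H : ℝ → A} {T : ℝ}

theorem timeOrderedExp_congr (h : Set.EqOn G H (Set.Icc 0 T)) :
    timeOrderedExp G T = timeOrderedExp H T := by
  unfold timeOrderedExp
  refine tsum_congr fun n => congrArg _ (orderedIntegral_congr fun t ht => ?_)
  simp only [h (ht.1 _)]

theorem Omega1_congr (hT : 0 ≤ T) (h : Set.EqOn G H (Set.Icc 0 T)) :
    Omega1 G T = Omega1 H T :=
  intervalIntegral.integral_congr (by rwa [Set.uIcc_of_le hT])

theorem Omega2_congr (h : Set.EqOn G H (Set.Icc 0 T)) : Omega2 G T = Omega2 H T := by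
  refine congrArg _ (orderedIntegral_congr fun t ht => ?_)
  simp only [h (ht.1 _)]

theorem Omega3_congr (h : Set.EqOn G H (Set.Icc 0 T)) : Omega3 G T = Omega3 H T := by
  refine congrArg _ (orderedIntegral_congr fun t ht => ?_)
  simp only [h (ht.1 _)]

theorem Omega4_congr (h : Set.EqOn G H (Set.Icc 0 T)) : Omega4 G T = Omega4 H T := by
  refine congrArg _ (orderedIntegral_congr fun t ht => ?_)
  simp only [h (ht.1 _)]

theorem Utar_eq_exp (H : ℝ → A) (T : ℝ) :
    Utar H T = NormedSpace.exp (-(Complex.I • Omega1 H T)) := by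
  rw [Utar, Omega1, neg_smul]

end Congruence

/-! ### The principal inverse square root of an exponential. -/

section InvSqrt

variable {E : Type*} [NormedAddCommGroup E] [InnerProductSpace ℂ E] [CompleteSpace E]

theorem isSelfAdjoint_Omega1 {H : ℝ → E →L[ℂ] E} (h : ∀ t, IsSelfAdjoint (H t)) (T : ℝ) :
    IsSelfAdjoint (Omega1 H T) := by
  have h1 : ∀ S : Set ℝ, star (∫ t in S, H t) = ∫ t in S, H t := fun S => by
    refine ((starL' ℝ : (E →L[ℂ] E) ≃L[ℝ] (E →L[ℂ] E)).integral_comp_comm H).symm.trans ?_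
    exact integral_congr_ae (ae_of_all _ fun t => (h t).star_eq)
  rw [IsSelfAdjoint, Omega1, intervalIntegral, star_sub, h1, h1]

theorem exp_mem_slitPlane {z : ℂ} (hz : ‖z‖ ≤ 1) : Complex.exp z ∈ Complex.slitPlane := by
  left
  rw [Complex.exp_re]
  have him : |z.im| ≤ 1 := (Complex.abs_im_le_norm z).trans hz
  exact mul_pos (Real.exp_pos _) (Real.cos_pos_of_le_one him)

theorem exp_cpow_neg_half {z : ℂ} (hz : ‖z‖ ≤ 1) :
    Complex.exp z ^ (-(1 / 2) : ℂ) = Complex.exp ((-(1 / 2) : ℂ) • z) := by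
  have him := abs_le.1 ((Complex.abs_im_le_norm z).trans hz)
  have hpi := Real.pi_gt_three
  rw [Complex.cpow_def_of_ne_zero (Complex.exp_ne_zero z),
    Complex.log_exp (by linarith) (by linarith), smul_eq_mul, mul_comm]

/-- The bound `‖x‖ ≤ 1` keeps the spectrum in `|Im z| ≤ 1 < π/2`, so `exp` maps it into the right
half-plane, where the principal power is continuous and `log` inverts `exp`. Composition in the
functional calculus does the rest. -/
theorem invSqrt_exp {x : E →L[ℂ] E} (hx : IsStarNormal x) (hn : ‖x‖ ≤ 1) :
    invSqrt (NormedSpace.exp x) = NormedSpace.exp ((-(1 / 2) : ℂ) • x) := by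
  have hspec : ∀ z ∈ spectrum ℂ x, ‖z‖ ≤ 1 := fun z hz => by
    have h := spectrum.subset_closedBall_norm_mul x hz
    rw [mem_closedBall_zero_iff] at h
    refine h.trans (mul_le_one₀ hn (norm_nonneg _) ContinuousLinearMap.norm_id_le)
  have hcont : ContinuousOn (fun z : ℂ => z ^ (-(1 / 2) : ℂ)) (Complex.exp '' spectrum ℂ x) := by
    rintro _ ⟨z, hz, rfl⟩
    exact (continuousAt_cpow_const (exp_mem_slitPlane (hspec z hz))).continuousWithinAt
  have hsmul : IsStarNormal ((-(1 / 2) : ℂ) • x) := inferInstance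
  rw [invSqrt, ← CFC.complex_exp_eq_normedSpace_exp hx, ← CFC.complex_exp_eq_normedSpace_exp hsmul,
    ← cfc_comp' (fun z : ℂ => z ^ (-(1 / 2) : ℂ)) Complex.exp x hcont,
    ← cfc_comp_smul (-(1 / 2) : ℂ) Complex.exp x]
  exact cfc_congr fun z hz => exp_cpow_neg_half (hspec z hz)

end InvSqrt

end Magnus

theorem mainTheorem3 :
    ∃ c : ℝ, 0 < c ∧ ∃ C : ℝ, 0 < C ∧
      ∀ (E : Type*) [NormedAddCommGroup E] [InnerProductSpace ℂ E] [CompleteSpace E]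
        (H : ℝ → E →L[ℂ] E) (K δT : ℝ),
        0 < δT →
        AEStronglyMeasurable H (volume.restrict (Set.Icc 0 δT)) →
        (∀ t ∈ Set.Icc 0 δT, IsSelfAdjoint (H t)) →
        (∀ t ∈ Set.Icc 0 δT, ‖H t‖ ≤ K) →
        (∀ t ∈ Set.Icc 0 δT, H t = H (δT - t)) →
        Magnus.Omega2 H δT = 0 ∧
        Magnus.Omega4 H δT = 0 ∧
        ‖Magnus.Omega3 H δT‖ ≤ C * (K * δT) ^ 3 ∧
        (K * δT ≤ c →
          (∃ R : E →L[ℂ] E, ‖R‖ ≤ C * (K * δT) ^ 5 ∧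
            Magnus.timeOrderedExp H δT =
              NormedSpace.exp
                (-(Complex.I • Magnus.Omega1 H δT) + Complex.I • Magnus.Omega3 H δT + R)) ∧
          ‖Magnus.timeOrderedExp H δT - Magnus.Utar H δT‖ ≤ C * (K * δT) ^ 3 ∧
          (∃ R : E →L[ℂ] E, ‖R‖ ≤ C * (K * δT) ^ 5 ∧
            Magnus.invSqrt (Magnus.Utar H δT) * Magnus.timeOrderedExp H δT *
                Magnus.invSqrt (Magnus.Utar H δT) =
              NormedSpace.exp (Complex.I • Magnus.Omega3 H δT + R))) := by
  -- `200 = 2 · 100`: both approximations have error `100 s⁵`, and passing to the exponent doubles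
  -- it. `s ≤ 1/20` makes that error smaller than the `1/16` allowed by `exists_exp_add_eq`.
  refine ⟨1 / 20, by norm_num, 200, by norm_num, ?_⟩
  intro E _ _ _ H K T hT hm hsa hK hsymm
  -- Extension by zero makes measurability, bound, self-adjointness and symmetry hold on all of `ℝ`,
  -- since `t ↦ T - t` also preserves the complement of `[0, T]`.
  obtain ⟨G, hG⟩ : ∃ G, G = (Set.Icc 0 T).indicator H := ⟨_, rfl⟩
  have hGH : Set.EqOn G H (Set.Icc 0 T) := fun t ht => by rw [hG, Set.indicator_of_mem ht]
  have hG0 : ∀ t ∉ Set.Icc 0 T, G t = 0 := fun t ht => by rw [hG, Set.indicator_of_notMem ht]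
  have hT0 := hT.le
  have hK0 : 0 ≤ K := (norm_nonneg _).trans (hK 0 ⟨le_rfl, hT0⟩)
  have hGm : AEStronglyMeasurable G volume := by
    rw [hG]
    exact (aestronglyMeasurable_indicator_iff measurableSet_Icc).2 hm
  have hGK : ∀ t, ‖G t‖ ≤ K := fun t => by
    by_cases ht : t ∈ Set.Icc 0 T
    · rw [hGH ht]; exact hK t ht
    · rw [hG0 t ht, norm_zero]; exact hK0
  have hGsa : ∀ t, IsSelfAdjoint (G t) := fun t => by
    by_cases ht : t ∈ Set.Icc 0 T
    · rw [hGH ht]; exact hsa t ht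
    · rw [hG0 t ht]; exact IsSelfAdjoint.zero _
  have hGsymm : ∀ t, G (T - t) = G t := fun t => by
    by_cases ht : t ∈ Set.Icc 0 T
    · have ht' : T - t ∈ Set.Icc 0 T := ⟨by linarith [ht.2], by linarith [ht.1]⟩
      rw [hGH ht, hGH ht', ← hsymm t ht]
    · have ht' : T - t ∉ Set.Icc 0 T := fun h => ht ⟨by linarith [h.2], by linarith [h.1]⟩
      rw [hG0 t ht, hG0 _ ht']
  rw [Magnus.Utar_eq_exp, ← Magnus.timeOrderedExp_congr hGH, ← Magnus.Omega1_congr hT0 hGH,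
    ← Magnus.Omega2_congr hGH, ← Magnus.Omega3_congr hGH, ← Magnus.Omega4_congr hGH]
  have hs0 : 0 ≤ K * T := mul_nonneg hK0 hT0
  have hO3 := Magnus.norm_Omega3_le hGK hT0
  refine ⟨Magnus.Omega2_eq_zero hGsymm, Magnus.Omega4_eq_zero hGsymm,
    hO3.trans (by gcongr; norm_num), fun hs => ?_⟩
  have h1 : ‖(1 : E →L[ℂ] E)‖ ≤ 1 := ContinuousLinearMap.norm_id_le
  have hu := Magnus.norm_timeOrderedExp_sub_le h1 hGm hGK hT0 hGsymm (by linarith)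
  have hx : ‖-(Complex.I • Magnus.Omega1 G T)‖ ≤ K * T := by
    rw [norm_neg, norm_smul, Complex.norm_I, one_mul]
    exact Magnus.norm_Omega1_le hGK hT0
  have hy : ‖Complex.I • Magnus.Omega3 G T‖ ≤ 2 * (K * T) ^ 3 := by
    rwa [norm_smul, Complex.norm_I, one_mul]
  have hxnormal : IsStarNormal (-(Complex.I • Magnus.Omega1 G T)) := by
    have := (Magnus.isSelfAdjoint_Omega1 hGsa T).isStarNormal
    infer_instance
  set x := -(Complex.I • Magnus.Omega1 G T)
  set y := Complex.I • Magnus.Omega3 G T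
  set u := Magnus.timeOrderedExp G T
  set s := K * T
  have hs2 : s ^ 2 ≤ 1 / 400 := by nlinarith
  have hs5 : s ^ 5 ≤ 1 / 400 * s ^ 3 := by
    have h := mul_le_mul_of_nonneg_right hs2 (pow_nonneg hs0 3)
    linarith [show s ^ 2 * s ^ 3 = s ^ 5 by ring]
  have hs3 : s ^ 3 ≤ 1 / 400 * s := by
    have h := mul_le_mul_of_nonneg_right hs2 hs0
    linarith [show s ^ 2 * s = s ^ 3 by ring]
  have hxy : ‖x + y‖ ≤ 1 / 8 := (norm_add_le_of_le hx hy).trans (by linarith)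
  obtain ⟨R, hR, hRu⟩ := Magnus.exists_exp_add_eq hxy (by linarith)
    (Magnus.norm_sub_exp_add_le hs0 hs hx hy hu)
  obtain ⟨R', hR', hRu'⟩ := Magnus.exists_exp_add_eq (hy.trans (by linarith)) (by linarith)
    (Magnus.norm_conj_sub_exp_le h1 hs0 hs hx hy hu)
  refine ⟨⟨R, hR.trans_eq (by ring), hRu.symm⟩, ?_, R', hR'.trans_eq (by ring), ?_⟩
  · rw [← hRu]
    have hxyR : ‖x + y + R‖ ≤ 1 / 4 := (norm_add_le_of_le hxy hR).trans (by linarith)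
    refine (Magnus.norm_exp_sub_exp_le hxyR (hx.trans (by linarith))).trans ?_
    have hd : x + y + R - x = y + R := by abel
    rw [hd]
    have := norm_add_le_of_le hy hR
    have h3 := pow_nonneg hs0 3
    linarith
  · rw [hRu', Magnus.invSqrt_exp hxnormal (hx.trans (by linarith))]
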